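/- **Model.** A fully-parallel Thompson circuit with $n$ inputs and $k$ binary outputs is laid out on the plane divided into unit grid squares. Each node occupies one square, different nodes occupy different squares, and a wire joins two nodes along a sequence of squares, each sharing a side with the next. A wire does not pass through the square of a node other than its two ends, and each side of a grid square is crossed at most once, by at most one wire (so wires may cross, and a node has at most four wires). Each of the $n$ inputs has its own input node, and each of the $k$ outputs has its own output node; a node may be both. All inputs are present at their input nodes at the start. In each clock cycle every wire carries one bit in each direction, sent by a node on the basis of its current state, and each node updates its state as an arbitrary function of its old state and the bits it receives. After $T$ clock cycles the outputs are read off the output nodes. The area $A$ is the number of grid squares occupied by nodes or wires, and the energy is $E=AT$. A fully-parallel decoding scheme is a sequence of such circuits $D_1,D_2,\dots$ with block lengths (numbers of inputs) $n_1<n_2<\cdots$ and numbers of decoded bits (outputs) $k=k(n_1),k(n_2),\dots$, together with encoding functions $\{0,1\}^{k}\to\{0,1\}^{n}$. Let $0<\epsilon<1$. The source consists of $k$ independent fair bits; it is encoded and sent by $n$ independent uses of the binary erasure channel with erasure probability $\epsilon$, and the decoder receives the channel output in $\{0,1,\text{erasure}\}^n$. The block error probability $P_{\mathrm e}(n)$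 is the probability that the output of the decoder of block length $n$ differs from the source word. For $f:\{1,2,\dots\}\to(0,\infty)$, the scheme is an $f(n)$-decoding scheme if $P_{\mathrm e}(n)<f(n)$ for all sufficiently large block lengths $n$ of the scheme. **Theorem.** Let $0<\epsilon<1$, and let $f:\{1,2,\dots\}\to(0,\infty)$ decrease monotonically to $0$ with $\lim_{n\to\infty}\frac{-\ln f(n)}{n}=0$. Then every fully-parallel $f(n)$-decoding scheme for the binary erasure channel with erasure probability $\epsilon$ satisfies, for all sufficiently large block lengths $n$ of the scheme, $$E=AT\ \ge\ c_3\sqrt{\frac{\ln f(n)}{\ln\epsilon}}\;k ,\qquad c_3=\frac{\sqrt{\ln 2}\,(\sqrt2-1)}{16\sqrt2},$$ and $$AT^2\ \ge\ c_4\,\frac{k^2\ln f(n)}{n\ln\epsilon},\qquad c_4=\frac{\ln 2\,(\sqrt2-1)^2}{512},$$ where $A$, $T$ and $k$ are the area, the number of clock cycles and the number of decoded bits of the decoder of block length $n$. -/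

import Mathlib

open Filter Topology

namespace Thompson

/-- The unit grid squares of the plane, indexed by `ℤ × ℤ`; two squares are adjacent when they
share a side. An edge of this graph is thus a side of a grid square. -/
def grid : SimpleGraph (ℤ × ℤ) where
  Adj p q := |p.1 - q.1| + |p.2 - q.2| = 1
  symm := ⟨fun p q h => by rwa [abs_sub_comm q.1, abs_sub_comm q.2]⟩
  loopless := ⟨fun p h => by simp at h⟩

/-- A fully-parallel circuit in the Thompson model, with `n` inputs from the alphabet `α` and `k`
binary outputs: a planar layout together with a synchronous computation on it.

A node occupies one grid square. A wire joins two nodes along a sequence of grid squares, each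
sharing a side with the next; it does not run over other nodes, and every side of a grid square is
crossed at most once, by at most one wire. So two wires may meet in a square that holds no node, and
a node has at most four wires. In every clock cycle a wire carries one bit in each direction.

Nodes may be arbitrarily powerful: `State` is any type, and `init`, `send`, `step`, `read` are any
functions. -/
structure FullyParallelCircuit (α : Type) (n k : ℕ) where
  Node : Type
  Wire : Type
  [fintypeNode : Fintype Node]
  [fintypeWire : Fintype Wire]
  /-- the grid square of a node -/
  pos : Node → ℤ × ℤ
  pos_injective : Function.Injective pos
  /-- the two ends of a wire -/
  src : Wire → Node
  dst : Wire → Node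
  /-- the grid squares along a wire -/
  route : (w : Wire) → grid.Walk (pos (src w)) (pos (dst w))
  route_isTrail : ∀ w, (route w).IsTrail
  route_avoids : ∀ w v, pos v ∈ (route w).support → v = src w ∨ v = dst w
  route_disjoint : ∀ w w', w ≠ w' → (route w).edges.Disjoint (route w').edges
  /-- every input has an input node of its own -/
  inNode : Fin n → Node
  inNode_injective : Function.Injective inNode
  /-- every output has an output node of its own, which may also be an input node -/
  outNode : Fin k → Node
  outNode_injective : Function.Injective outNode
  State : Type
  /-- initial state of a node: it depends on `some a` at an input node with input `a`, and on
  `none` at the other nodes -/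
  init : Node → Option α → State
  /-- the bit that a node puts on a wire -/
  send : Node → State → Wire → Bool
  /-- the new state of a node, given its old state and the bits received on its wires -/
  step : Node → State → (Wire → Bool) → State
  /-- the output bit shown by a node -/
  read : Node → State → Bool
  /-- the number `T` of clock cycles -/
  cycles : ℕ

namespace FullyParallelCircuit

attribute [instance] fintypeNode fintypeWire

variable {α : Type} {n k : ℕ}

/-- The area: the number of grid squares occupied by nodes or wires. -/
def area (C : FullyParallelCircuit α n k) : ℕ :=
  (Finset.univ.image C.pos ∪ Finset.univ.biUnion fun w => (C.route w).support.toFinset).card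

open Classical in
/-- The bits that node `v` receives in one clock cycle when the nodes are in the states `s`: on each
of its wires, the bit sent from the other end; on wires not attached to `v`, the constant `false`. -/
noncomputable def received (C : FullyParallelCircuit α n k) (s : C.Node → C.State) (v : C.Node)
    (w : C.Wire) : Bool :=
  if C.src w = v then C.send (C.dst w) (s (C.dst w)) w
  else if C.dst w = v then C.send (C.src w) (s (C.src w)) w
  else false

/-- The states of the nodes after `t` clock cycles on the input `y`. -/
noncomputable def stateAt (C : FullyParallelCircuit α n k) (y : Fin n → α) :
    ℕ → C.Node → C.State
  | 0, v => C.init v (Function.extend C.inNode (fun i => some (y i)) (fun _ => none) v)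
  | t + 1, v => C.step v (stateAt C y t v) (C.received (stateAt C y t) v)

/-- The function computed by the circuit. -/
noncomputable def compute (C : FullyParallelCircuit α n k) (y : Fin n → α) : Fin k → Bool :=
  fun j => C.read (C.outNode j) (C.stateAt y C.cycles (C.outNode j))

/-- The Thompson energy `E = A T`. -/
def energy (C : FullyParallelCircuit α n k) : ℕ := C.area * C.cycles

end FullyParallelCircuit

/-- Transition probabilities of the binary erasure channel with erasure probability `ε`; the output
`none` is an erasure. -/
def erasureChannel (ε : ℝ) (x : Bool) : Option Bool → ℝ
  | none => ε
  | some b => if b = x then 1 - ε else 0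

/-- The probability that `dec` fails to return the source word, when the source is `k` independent
fair bits, encoded by `enc` and sent by `n` independent uses of the binary erasure channel. -/
noncomputable def blockErrorProb {n k : ℕ} (ε : ℝ) (enc : (Fin k → Bool) → Fin n → Bool)
    (dec : (Fin n → Option Bool) → Fin k → Bool) : ℝ :=
  ∑ x : Fin k → Bool, (1 / 2 : ℝ) ^ k *
    ∑ y : Fin n → Option Bool,
      (∏ i, erasureChannel ε (enc x i) (y i)) * (if dec y = x then 0 else 1)

/-- A fully-parallel decoding scheme: an infinite sequence of decoder circuits with increasing block
lengths, together with their codes. -/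
structure DecodingScheme where
  /-- block lengths -/
  n : ℕ → ℕ
  n_strictMono : StrictMono n
  /-- numbers of bits decoded -/
  k : ℕ → ℕ
  encoder : (i : ℕ) → (Fin (k i) → Bool) → Fin (n i) → Bool
  decoder : (i : ℕ) → FullyParallelCircuit (Option Bool) (n i) (k i)

namespace DecodingScheme

/-- Block error probability of the `i`-th decoder. -/
noncomputable def errorProb (D : DecodingScheme) (ε : ℝ) (i : ℕ) : ℝ :=
  blockErrorProb ε (D.encoder i) (D.decoder i).compute

/-- `D` is an `f(n)`-decoding scheme for the binary erasure channel with erasure probability `ε`: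
for sufficiently large block length `n`, the block error probability is less than `f n`. -/
def IsDecodingSchemeFor (D : DecodingScheme) (ε : ℝ) (f : ℕ → ℝ) : Prop :=
  ∀ᶠ i in atTop, D.errorProb ε i < f (D.n i)

end DecodingScheme

/-- A sublinear function. -/
def Sublinear (g : ℕ → ℝ) : Prop := Tendsto (fun n : ℕ => g n / n) atTop (𝓝 0)

end Thompson

/-! Divide the plane into regions with at most `L` inputs each. With probability at least `ε ^ L`
all inputs in a given region `R` are erased. The outputs in `R` then depend on the source only
through the bits that cross the boundary of `R`, at most `T` per cut wire. If there are fewer such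
bits than outputs in `R`, then for every erasure pattern outside `R` at least half of the source
words are decoded wrongly, so the error probability is at least `ε ^ L / 2` (`card_outputs_le`).
When `f n ≤ ε ^ L / 2` this is impossible. Every region then pays for its own outputs, and summing
over the regions gives `k ≤ 2 T |E|`, where `E` is the set of sides between regions
(`outputs_le_of_regions`).

The regions come from an explicit cut of the grid rather than from repeated bisection
(`exists_regions`). The squares are read strip by strip, in vertical strips of width `w`, and the
reading is cut after every `L` inputs. The strip borders cost at most `A / w` sides for a suitable
offset, and each of the at most `n / L` cuts costs `w + 1`. Balancing with `w ≈ √(A L / n)` gives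
`k² L ≤ 144 A T² n` (`sq_outputs_mul_le`). Taking `L` near `ln f / (2 ln ε)` yields the bound on `A
T²`, and `A ≥ n` turns it into the bound on the energy. -/

namespace Thompson

/-! ### Information flow into a set of nodes -/

namespace FullyParallelCircuit

variable {α : Type} {n k : ℕ}

open Classical in
/-- The wires with exactly one end in the set `R` of nodes. -/
noncomputable def cutWires (C : FullyParallelCircuit α n k) (R : Set C.Node) : Finset C.Wire :=
  {w | ¬ (C.src w ∈ R ↔ C.dst w ∈ R)}

open Classical in
/-- The bits that enter the set `R` of nodes during the computation on the input `y`. -/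
noncomputable def transcript (C : FullyParallelCircuit α n k) (R : Set C.Node) (y : Fin n → α) :
    Fin C.cycles × C.cutWires R → Bool :=
  fun q => C.received (C.stateAt y q.1) (if C.src q.2 ∈ R then C.src q.2 else C.dst q.2) q.2

/-- The states inside `R` are determined by the inputs inside `R` and by the transcript. -/
theorem stateAt_congr (C : FullyParallelCircuit α n k) {R : Set C.Node} {y y' : Fin n → α}
    (hin : ∀ i, C.inNode i ∈ R → y i = y' i) (htr : C.transcript R y = C.transcript R y') :
    ∀ t ≤ C.cycles, ∀ v ∈ R, C.stateAt y t v = C.stateAt y' t v := by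
  intro t
  induction t with
  | zero =>
    intro _ v hv
    simp only [stateAt]
    congr 1
    by_cases h : ∃ i, C.inNode i = v
    · obtain ⟨i, rfl⟩ := h
      rw [C.inNode_injective.extend_apply, C.inNode_injective.extend_apply, hin i hv]
    · rw [Function.extend_apply' _ _ _ h, Function.extend_apply' _ _ _ h]
  | succ t ih =>
    intro ht v hv
    have ih' := ih (by omega)
    simp only [stateAt]
    rw [ih' v hv]
    congr 1
    funext w
    -- A wire at `v` either crosses the boundary of `R`, and its bit is recorded in the transcript,
    -- or has both ends in `R`, where the induction hypothesis fixes the bit sent.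
    by_cases hw : w ∈ C.cutWires R
    · have h := congrFun htr (⟨t, by omega⟩, ⟨w, hw⟩)
      simp only [transcript] at h
      simp only [cutWires, Finset.mem_filter, Finset.mem_univ, true_and] at hw
      by_cases hs : C.src w = v
      · rwa [if_pos (hs ▸ hv), hs] at h
      · by_cases hd : C.dst w = v
        · have : C.src w ∉ R := fun h' => hw ⟨fun _ => hd ▸ hv, fun _ => h'⟩
          rwa [if_neg this, hd] at h
        · simp [received, hs, hd]
    · have hiff : C.src w ∈ R ↔ C.dst w ∈ R := by simpa [cutWires] using hw
      unfold received
      split_ifs with hs hd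
      · rw [ih' _ (hiff.1 (hs ▸ hv))]
      · rw [ih' _ (hiff.2 (hd ▸ hv))]
      · rfl

/-- The outputs inside `R` are determined by the inputs inside `R` and by the transcript. -/
theorem compute_congr (C : FullyParallelCircuit α n k) {R : Set C.Node} {y y' : Fin n → α}
    (hin : ∀ i, C.inNode i ∈ R → y i = y' i) (htr : C.transcript R y = C.transcript R y')
    {j : Fin k} (hj : C.outNode j ∈ R) : C.compute y j = C.compute y' j := by
  simp only [compute]
  rw [C.stateAt_congr hin htr _ le_rfl _ hj]

open Classical in
/-- If the inputs inside `R` carry no information on the source word `x`, then the number of source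
words that are decoded correctly is limited by the number of bits that enter `R`. -/
theorem card_decoded_le (C : FullyParallelCircuit α n k) (R : Set C.Node)
    (Y : (Fin k → Bool) → Fin n → α) (hY : ∀ x x' i, C.inNode i ∈ R → Y x i = Y x' i) :
    ({x | C.compute (Y x) = x} : Finset (Fin k → Bool)).card *
        2 ^ ({j | C.outNode j ∈ R} : Finset (Fin k)).card ≤
      2 ^ (C.cycles * (C.cutWires R).card) * 2 ^ k := by
  -- A correctly decoded word equals its output. Its bits in `R` are thus functions of the
  -- transcript alone, and its other bits are listed explicitly.
  have hinj : Set.InjOn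
      (fun x : Fin k → Bool =>
        (C.transcript R (Y x), fun j : {j : Fin k // C.outNode j ∉ R} => x j))
      ({x | C.compute (Y x) = x} : Finset (Fin k → Bool)) := by
    intro x hx x' hx' h
    simp only [Finset.coe_filter, Finset.mem_univ, true_and, Set.mem_ofPred_eq] at hx hx'
    simp only [Prod.mk.injEq] at h
    funext j
    by_cases hj : C.outNode j ∈ R
    · rw [← hx, ← hx']
      exact C.compute_congr (hY x x') h.1 hj
    · exact congrFun h.2 ⟨j, hj⟩
  have hcard := Finset.card_le_card_of_injOn (t := Finset.univ) _ (fun _ _ => Finset.mem_univ _) hinj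
  simp only [Finset.card_univ, Fintype.card_prod, Fintype.card_fun, Fintype.card_bool,
    Fintype.card_fin, Fintype.card_coe] at hcard
  rw [Fintype.card_subtype] at hcard
  calc _ ≤ _ := Nat.mul_le_mul_right _ hcard
    _ = _ := by
      rw [mul_assoc, ← pow_add]
      congr 2
      have := Finset.card_filter_add_card_filter_not (s := (Finset.univ : Finset (Fin k)))
        (fun j => C.outNode j ∈ R)
      simp only [Finset.card_univ, Fintype.card_fin] at this
      omega

end FullyParallelCircuit

/-! ### The error probability when a set of inputs is erased -/

theorem erasureChannel_nonneg {ε : ℝ} (hε0 : 0 ≤ ε) (hε1 : ε ≤ 1) (x : Bool) (y : Option Bool) :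
    0 ≤ erasureChannel ε x y := by
  cases y with
  | none => exact hε0
  | some b =>
    simp only [erasureChannel]
    split_ifs <;> linarith

/-- The word `c` with the letters in the positions marked by `e` erased. -/
def erase {n : ℕ} (c : Fin n → Bool) (e : Fin n → Bool) : Fin n → Option Bool :=
  fun i => if e i then none else some (c i)

theorem erase_injective {n : ℕ} (c : Fin n → Bool) : Function.Injective (erase c) := by
  intro e e' h
  funext i
  have := congrFun h i
  simp only [erase] at this
  cases h1 : e i <;> cases h2 : e' i <;> simp_all

/-- If for every erasure pattern that contains `I` at most half of the source words are decoded
correctly, then the block error probability is at least half the probability that all of `I` is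
erased. -/
theorem half_pow_card_le_blockErrorProb {n k : ℕ} {ε : ℝ} (hε0 : 0 ≤ ε) (hε1 : ε ≤ 1)
    (enc : (Fin k → Bool) → Fin n → Bool) (dec : (Fin n → Option Bool) → Fin k → Bool)
    (I : Finset (Fin n))
    (h : ∀ e : Fin n → Bool, (∀ i ∈ I, e i = true) →
      2 * ({x | dec (erase (enc x) e) = x} : Finset (Fin k → Bool)).card ≤ 2 ^ k) :
    ε ^ I.card / 2 ≤ blockErrorProb ε enc dec := by
  set p : Bool → ℝ := fun b => if b then ε else 1 - ε with hp
  have hp0 : ∀ b, 0 ≤ p b := by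
    intro b
    cases b <;> simp [hp] <;> linarith
  -- `Fintype.piFinset s` is the set of erasure patterns that contain `I`.
  set s : Fin n → Finset Bool := fun i => if i ∈ I then {true} else Finset.univ with hs
  have hsum : ∑ e ∈ Fintype.piFinset s, ∏ i, p (e i) = ε ^ I.card := by
    rw [← Finset.prod_univ_sum]
    have : ∀ i, ∑ b ∈ s i, p b = if i ∈ I then ε else 1 := by
      intro i
      by_cases hi : i ∈ I <;> simp [hs, hp, hi]
    simp [this, Finset.prod_ite_mem]
  have hx : ∀ x : Fin k → Bool,
      ∑ e ∈ Fintype.piFinset s, (∏ i, p (e i)) * (if dec (erase (enc x) e) = x then 0 else 1) ≤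
        ∑ y : Fin n → Option Bool,
          (∏ i, erasureChannel ε (enc x i) (y i)) * (if dec y = x then (0 : ℝ) else 1) := by
    intro x
    have hch : ∀ e, ∏ i, p (e i) = ∏ i, erasureChannel ε (enc x i) (erase (enc x) e i) := by
      intro e
      refine Finset.prod_congr rfl fun i _ => ?_
      cases h1 : e i <;> simp [hp, erase, erasureChannel, h1]
    simp_rw [hch]
    rw [← Finset.sum_image (f := fun y : Fin n → Option Bool =>
      (∏ i, erasureChannel ε (enc x i) (y i)) * (if dec y = x then (0 : ℝ) else 1))
      (g := erase (enc x)) ((erase_injective (enc x)).injOn)]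
    refine Finset.sum_le_sum_of_subset_of_nonneg (Finset.subset_univ _) fun y _ _ => ?_
    refine mul_nonneg (Finset.prod_nonneg fun i _ => erasureChannel_nonneg hε0 hε1 _ _) ?_
    split_ifs <;> norm_num
  have he : ∀ e ∈ Fintype.piFinset s, (1 / 2 : ℝ) ≤
      ∑ x : Fin k → Bool, (1 / 2 : ℝ) ^ k * (if dec (erase (enc x) e) = x then 0 else 1) := by
    intro e hemem
    have h1 := h e fun i hi => by
      have := (Fintype.mem_piFinset.1 hemem) i
      simpa [hs, hi] using this
    have h2 : ∑ x : Fin k → Bool, (if dec (erase (enc x) e) = x then (0 : ℝ) else 1) =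
        2 ^ k - ({x | dec (erase (enc x) e) = x} : Finset (Fin k → Bool)).card := by
      have : ∀ x : Fin k → Bool, (if dec (erase (enc x) e) = x then (0 : ℝ) else 1) =
          1 - (if dec (erase (enc x) e) = x then (1 : ℝ) else 0) := by
        intro x; split_ifs <;> norm_num
      simp [this, Finset.sum_sub_distrib]
    rw [← Finset.mul_sum, h2]
    have h3 : (2 : ℝ) * ({x | dec (erase (enc x) e) = x} : Finset (Fin k → Bool)).card ≤ 2 ^ k := by
      exact_mod_cast h1
    have h4 : (1 / 2 : ℝ) ^ k * 2 ^ k = 1 := by rw [← mul_pow]; norm_num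
    have h5 : (0 : ℝ) < (1 / 2) ^ k := by positivity
    nlinarith
  calc ε ^ I.card / 2 = ∑ e ∈ Fintype.piFinset s, (∏ i, p (e i)) * (1 / 2) := by
        rw [← Finset.sum_mul, hsum]; ring
    _ ≤ ∑ e ∈ Fintype.piFinset s, (∏ i, p (e i)) * ∑ x : Fin k → Bool,
          (1 / 2 : ℝ) ^ k * (if dec (erase (enc x) e) = x then 0 else 1) :=
        Finset.sum_le_sum fun e hemem =>
          mul_le_mul_of_nonneg_left (he e hemem) (Finset.prod_nonneg fun i _ => hp0 _)
    _ = ∑ x : Fin k → Bool, (1 / 2 : ℝ) ^ k * ∑ e ∈ Fintype.piFinset s,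
          (∏ i, p (e i)) * (if dec (erase (enc x) e) = x then 0 else 1) := by
        simp_rw [Finset.mul_sum]
        rw [Finset.sum_comm]
        exact Finset.sum_congr rfl fun x _ => Finset.sum_congr rfl fun e _ => by ring
    _ ≤ blockErrorProb ε enc dec :=
        Finset.sum_le_sum fun x _ => mul_le_mul_of_nonneg_left (hx x) (by positivity)

open Classical in
/-- A decoder with small error probability must send at least as many bits into a set `R` of nodes
as there are outputs in `R`. -/
theorem card_outputs_le {n k : ℕ} {ε : ℝ} (hε0 : 0 ≤ ε) (hε1 : ε ≤ 1)
    (enc : (Fin k → Bool) → Fin n → Bool) (C : FullyParallelCircuit (Option Bool) n k)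
    (R : Set C.Node)
    (hP : blockErrorProb ε enc C.compute <
      ε ^ ({i | C.inNode i ∈ R} : Finset (Fin n)).card / 2) :
    ({j | C.outNode j ∈ R} : Finset (Fin k)).card ≤ C.cycles * (C.cutWires R).card := by
  by_contra! hlt
  refine hP.not_ge (half_pow_card_le_blockErrorProb hε0 hε1 enc C.compute _ fun e he => ?_)
  have h := C.card_decoded_le R (fun x => erase (enc x) e) (by
    intro x x' i hi
    simp [erase, he i (by simpa using hi)])
  -- A deficit of a single bit supplies the factor 2 that makes at least half of the words fail.
  have h2 : 2 * 2 ^ (C.cycles * (C.cutWires R).card) ≤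
      2 ^ ({j | C.outNode j ∈ R} : Finset (Fin k)).card := by
    rw [← pow_succ']
    exact Nat.pow_le_pow_right (by norm_num) hlt
  refine Nat.le_of_mul_le_mul_left ?_ 
    (show 0 < 2 ^ (C.cycles * (C.cutWires R).card) by positivity)
  calc _ = ({x | C.compute (erase (enc x) e) = x} : Finset (Fin k → Bool)).card *
          (2 * 2 ^ (C.cycles * (C.cutWires R).card)) := by ring
    _ ≤ _ := Nat.mul_le_mul_left _ h2
    _ ≤ _ := by convert h

end Thompson

namespace Thompson

/-! ### Ranks in a linear order -/

section Rank

variable {K : Type*} [LinearOrder K] {n : ℕ} (a : Fin n → K)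

/-- The number of members of the family `a` that lie below `c`. -/
def rank (c : K) : ℕ := ({i | a i < c} : Finset (Fin n)).card

theorem rank_mono {c d : K} (h : c ≤ d) : rank a c ≤ rank a d := by
  refine Finset.card_le_card fun i hi => ?_
  simp only [Finset.mem_filter, Finset.mem_univ, true_and] at hi ⊢
  exact hi.trans_le h

theorem rank_le (c : K) : rank a c ≤ n := by
  simpa [rank] using Finset.card_le_univ ({i | a i < c} : Finset (Fin n))

theorem rank_apply_lt {t : Fin n} {c : K} (h : a t < c) : rank a (a t) < rank a c := by
  refine Finset.card_lt_card (Finset.ssubset_iff_of_subset ?_ |>.2 ⟨t, ?_, ?_⟩)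
  · intro i hi
    simp only [Finset.mem_filter, Finset.mem_univ, true_and] at hi ⊢
    exact hi.trans h
  · simpa using h
  · simp

theorem rank_apply_lt_card (t : Fin n) : rank a (a t) < n := by
  have : rank a (a t) < (Finset.univ : Finset (Fin n)).card :=
    Finset.card_lt_card (Finset.ssubset_iff_of_subset (Finset.subset_univ _) |>.2
      ⟨t, Finset.mem_univ _, by simp⟩)
  simpa using this

variable {a}

theorem rank_apply_injective (ha : Function.Injective a) :
    Function.Injective fun t => rank a (a t) := by
  intro s t h
  simp only at h
  rcases lt_trichotomy (a s) (a t) with h1 | h1 | h1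
  · exact absurd h (rank_apply_lt a h1).ne
  · exact ha h1
  · exact absurd h (rank_apply_lt a h1).ne'

/-- An injective map of `Fin n` to itself is onto, so the ranks of the members are exactly `0, …, n
- 1`. -/
theorem exists_rank_apply_eq (ha : Function.Injective a) {m : ℕ} (hm : m < n) :
    ∃ t, rank a (a t) = m := by
  have hinj : Function.Injective fun t => (⟨rank a (a t), rank_apply_lt_card a t⟩ : Fin n) :=
    fun s t h => rank_apply_injective ha (congrArg Fin.val h)
  obtain ⟨t, ht⟩ := Finite.injective_iff_surjective.1 hinj ⟨m, hm⟩
  exact ⟨t, congrArg Fin.val ht⟩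

/-- Between two elements whose ranks fall into different classes of `L` consecutive numbers, there
is a member of `a` that ends a class. -/
theorem exists_separating (ha : Function.Injective a) {L : ℕ} {c d : K} (hcd : c < d)
    (hne : rank a c / L ≠ rank a d / L) :
    ∃ t, L ∣ rank a (a t) + 1 ∧ c ≤ a t ∧ a t < d := by
  have hL : 0 < L := Nat.pos_of_ne_zero fun h => hne (by simp [h])
  have hlt : rank a c / L < rank a d / L :=
    lt_of_le_of_ne (Nat.div_le_div_right (rank_mono a hcd.le)) hne
  have h1 : rank a c < L * (rank a d / L) := by
    rw [mul_comm]; exact (Nat.div_lt_iff_lt_mul hL).1 hlt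
  have h2 : L * (rank a d / L) ≤ rank a d := Nat.mul_div_le _ _
  have h3 := rank_le a d
  -- The last member before the class of `d` begins.
  obtain ⟨t, ht⟩ := exists_rank_apply_eq ha (m := L * (rank a d / L) - 1) (by omega)
  refine ⟨t, ⟨rank a d / L, by omega⟩, ?_, ?_⟩
  · by_contra! h
    have := rank_apply_lt a h
    omega
  · by_contra! h
    have := rank_mono a h
    omega

/-- The numbers `rank + 1` are distinct and lie in `1, …, n`. This bounds the number of cuts inside
the strips. -/
theorem card_dvd_rank_add_one_le (ha : Function.Injective a) (L : ℕ) :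
    ({t | L ∣ rank a (a t) + 1} : Finset (Fin n)).card ≤ n / L := by
  rw [← Nat.Ioc_filter_dvd_card_eq_div]
  refine Finset.card_le_card_of_injOn (fun t => rank a (a t) + 1) ?_ ?_
  · intro t ht
    have := rank_apply_lt_card a t
    simp only [Finset.coe_filter, Finset.mem_univ, true_and, Set.mem_ofPred_eq] at ht
    simp only [Finset.coe_filter, Finset.mem_Ioc, Set.mem_ofPred_eq]
    exact ⟨⟨by omega, by omega⟩, ht⟩
  · intro s _ t _ h
    exact rank_apply_injective ha (by simpa using h)

theorem card_rank_div_eq_le (ha : Function.Injective a) {L : ℕ} (hL : 0 < L) (m : ℕ) :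
    ({t | rank a (a t) / L = m} : Finset (Fin n)).card ≤ L := by
  have hI : (Finset.Ico (m * L) (m * L + L)).card = L := by simp
  refine le_trans (Finset.card_le_card_of_injOn (fun t => rank a (a t)) ?_
    ((rank_apply_injective ha).injOn)) hI.le
  intro t ht
  simp only [Finset.coe_filter, Finset.mem_univ, true_and, Set.mem_ofPred_eq] at ht
  rw [Nat.div_eq_iff hL] at ht
  simp only [Finset.coe_Ico, Set.mem_Ico]
  omega

end Rank

/-! ### Cutting the grid -/

/-- The vertical strip of width `w` that contains the column `x`; the strips end at the columns
congruent to `r` modulo `w`. -/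
def strip (w r x : ℤ) : ℤ := (x - r - 1) / w

/-- Grid squares are ordered by strip, then by row, then by column. -/
def stripKey (w r : ℤ) (p : ℤ × ℤ) : ℤ ×ₗ (ℤ ×ₗ ℤ) := toLex (strip w r p.1, toLex (p.2, p.1))

theorem stripKey_injective (w r : ℤ) : Function.Injective (stripKey w r) := by
  intro p q h
  simp only [stripKey, EmbeddingLike.apply_eq_iff_eq, Prod.mk.injEq] at h
  exact Prod.ext h.2.2 h.2.1

theorem stripKey_lt {w r : ℤ} {p q : ℤ × ℤ} : stripKey w r p < stripKey w r q ↔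
    strip w r p.1 < strip w r q.1 ∨ strip w r p.1 = strip w r q.1 ∧
      (p.2 < q.2 ∨ p.2 = q.2 ∧ p.1 < q.1) := by
  simp only [stripKey, Prod.Lex.toLex_lt_toLex]

theorem stripKey_le {w r : ℤ} {p q : ℤ × ℤ} : stripKey w r p ≤ stripKey w r q ↔
    strip w r p.1 < strip w r q.1 ∨ strip w r p.1 = strip w r q.1 ∧
      (p.2 < q.2 ∨ p.2 = q.2 ∧ p.1 ≤ q.1) := by
  simp only [stripKey, Prod.Lex.toLex_le_toLex]

/-- The `- 1` in `strip` makes a column congruent to `r` the last one of its strip, so only there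
does the quotient jump. -/
theorem strip_add_one {w r x : ℤ} (hw : 0 < w) (h : ¬ x ≡ r [ZMOD w]) :
    strip w r (x + 1) = strip w r x := by
  unfold strip
  have hm : (x - r) % w ≠ 0 := fun h0 =>
    h (Int.ModEq.symm ((Int.modEq_iff_dvd).2 (Int.dvd_of_emod_eq_zero h0)))
  have h1 := lt_of_le_of_ne (Int.emod_nonneg (x - r) hw.ne') hm.symm
  have h2 := Int.emod_lt_of_pos (x - r) hw
  have h3 := Int.mul_ediv_add_emod (x - r) w
  have e1 : x + 1 - r - 1 = x - r := by ring
  rw [e1]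
  symm
  rw [Int.ediv_eq_iff_of_pos hw]
  constructor <;> nlinarith

theorem mem_Ico_of_strip_eq {w r x : ℤ} (hw : 0 < w) {b : ℤ} (h : strip w r x = b) :
    x ∈ Finset.Ico (b * w + r + 1) (b * w + r + 1 + w) := by
  unfold strip at h
  rw [Int.ediv_eq_iff_of_pos hw] at h
  rw [Finset.mem_Ico]
  constructor <;> nlinarith

/-- The side between the square `p` and its right neighbour. -/
def rightSide (p : ℤ × ℤ) : Sym2 (ℤ × ℤ) := s(p, (p.1 + 1, p.2))

/-- The side in column `x` that separates the squares up to `t` from those after `t`, in the order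
of a strip that contains both. -/
def rowSide (t : ℤ × ℤ) (x : ℤ) : Sym2 (ℤ × ℤ) :=
  if x ≤ t.1 then s((x, t.2), (x, t.2 + 1)) else s((x, t.2 - 1), (x, t.2))

/-- The sides inside a strip that separate the squares up to `t` from those after `t`. -/
noncomputable def sidesAt (w r : ℤ) (t : ℤ × ℤ) : Finset (Sym2 (ℤ × ℤ)) :=
  insert (rightSide t) ((Finset.Ico (strip w r t.1 * w + r + 1)
    (strip w r t.1 * w + r + 1 + w)).image (rowSide t))

/-- The cut after `t` is a staircase: one horizontal side in each of the `w` columns, and one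
vertical step to the right of `t`. -/
theorem card_sidesAt_le (w : ℕ) (r : ℤ) (t : ℤ × ℤ) : (sidesAt w r t).card ≤ w + 1 := by
  refine (Finset.card_insert_le _ _).trans (Nat.add_le_add_right ?_ 1)
  refine Finset.card_image_le.trans ?_
  simp

theorem grid_adj_cases {p q : ℤ × ℤ} (h : grid.Adj p q) :
    q = (p.1 + 1, p.2) ∨ p = (q.1 + 1, q.2) ∨ q = (p.1, p.2 + 1) ∨ p = (q.1, q.2 + 1) := by
  have h : |p.1 - q.1| + |p.2 - q.2| = 1 := h
  simp only [Prod.ext_iff]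
  rcases abs_cases (p.1 - q.1) with h1 | h1 <;> rcases abs_cases (p.2 - q.2) with h2 | h2 <;> omega

/-- A side between consecutive squares `p ≤ t < q` either ends a strip or is one of `sidesAt t`. -/
theorem side_cases {w r : ℤ} (hw : 0 < w) {p q t : ℤ × ℤ} (h : grid.Adj p q)
    (hpt : stripKey w r p ≤ stripKey w r t) (htq : stripKey w r t < stripKey w r q) :
    (∃ u, (u = p ∨ u = q) ∧ u.1 ≡ r [ZMOD w] ∧ s(p, q) = rightSide u) ∨
      s(p, q) ∈ sidesAt w r t := by
  rw [stripKey_le] at hpt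
  rw [stripKey_lt] at htq
  obtain ⟨px, py⟩ := p
  obtain ⟨qx, qy⟩ := q
  obtain ⟨tx, ty⟩ := t
  have key : strip w r px = strip w r qx → strip w r tx = strip w r px ∧
      (py < ty ∨ py = ty ∧ px ≤ tx) ∧ (ty < qy ∨ ty = qy ∧ tx < qx) := by
    intro he
    simp only at hpt htq
    rw [he] at hpt ⊢
    omega
  -- Within a strip, `p ≤ t < q` leaves two directions from `p` to `q`. A step to the right forces
  -- `t = p`. A step up puts `t` in the row of `p`, weakly to the right, or in the row of `q`,
  -- strictly to the left: the two branches of `rowSide`.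
  rcases grid_adj_cases h with h | h | h | h <;> simp only [Prod.mk.injEq] at h <;>
    obtain ⟨rfl, rfl⟩ := h
  · by_cases hm : px ≡ r [ZMOD w]
    · exact Or.inl ⟨_, Or.inl rfl, hm, rfl⟩
    · obtain ⟨-, h2, h3⟩ := key (strip_add_one hw hm).symm
      refine Or.inr (Finset.mem_insert.2 (Or.inl ?_))
      have e1 : tx = px := by omega
      have e2 : ty = qy := by omega
      rw [e1, e2]; rfl
  · by_cases hm : qx ≡ r [ZMOD w]
    · exact Or.inl ⟨_, Or.inr rfl, hm, Sym2.eq_swap⟩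
    · obtain ⟨-, h2, h3⟩ := key (strip_add_one hw hm)
      omega
  · obtain ⟨h1, h2, h3⟩ := key rfl
    refine Or.inr (Finset.mem_insert.2 (Or.inr ?_))
    refine Finset.mem_image.2 ⟨qx, mem_Ico_of_strip_eq hw h1.symm, ?_⟩
    simp only [rowSide]
    split_ifs with hx
    · rw [show ty = py by omega]
    · rw [show ty = py + 1 by omega, add_sub_cancel_right]
  · obtain ⟨h1, h2, h3⟩ := key rfl
    omega

/-- Pigeonhole: some residue class of columns holds at most the average number of squares. -/
theorem exists_residue (S : Finset (ℤ × ℤ)) {w : ℕ} (hw : 0 < w) :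
    ∃ r : ℤ, w * (S.filter fun p => p.1 ≡ r [ZMOD w]).card ≤ S.card := by
  by_contra! h
  have hsum : S.card = ∑ r ∈ Finset.Ico (0 : ℤ) w, (S.filter fun p => p.1 % w = r).card :=
    Finset.card_eq_sum_card_fiberwise fun p _ => by
      simp only [Finset.coe_Ico, Set.mem_Ico]
      exact ⟨Int.emod_nonneg _ (by omega), Int.emod_lt_of_pos _ (by omega)⟩
  have hlt : ∑ r ∈ Finset.Ico (0 : ℤ) w, S.card <
      ∑ r ∈ Finset.Ico (0 : ℤ) w, w * (S.filter fun p => p.1 % w = r).card := by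
    refine Finset.sum_lt_sum_of_nonempty ⟨0, by simp; omega⟩ fun r hr => ?_
    rw [Finset.mem_Ico] at hr
    have := h r
    rwa [show (S.filter fun p => p.1 ≡ r [ZMOD w]) = S.filter fun p => p.1 % w = r by
      simp only [Int.ModEq, Int.emod_eq_of_lt hr.1 hr.2]] at this
  rw [← Finset.mul_sum, ← hsum] at hlt
  simp at hlt

/-- The squares of the grid can be divided into regions, each with at most `L` of the given points
`pt i`, such that few sides between squares of `S` separate different regions. -/
theorem exists_regions (S : Finset (ℤ × ℤ)) {n : ℕ} {pt : Fin n → ℤ × ℤ}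
    (hpt : Function.Injective pt) {w L : ℕ} (hw : 0 < w) (hL : 0 < L) :
    ∃ (ρ : ℤ × ℤ → ℕ) (E : Finset (Sym2 (ℤ × ℤ))),
      (∀ m, ({i | ρ (pt i) = m} : Finset (Fin n)).card ≤ L) ∧
      (∀ p ∈ S, ∀ q ∈ S, grid.Adj p q → ρ p ≠ ρ q → s(p, q) ∈ E) ∧
      w * E.card ≤ S.card + w * (n / L * (w + 1)) := by
  obtain ⟨r, hr⟩ := exists_residue S hw
  set a : Fin n → ℤ ×ₗ (ℤ ×ₗ ℤ) := fun i => stripKey w r (pt i) with ha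
  have hinj : Function.Injective a := (stripKey_injective w r).comp hpt
  -- `H` holds the borders between strips, `V` the staircases inside them. The region of a square is
  -- the number of points before it in strip order, divided by `L`.
  set H := (S.filter fun p => p.1 ≡ r [ZMOD w]).image rightSide with hH
  set V := ({t | L ∣ rank a (a t) + 1} : Finset (Fin n)).biUnion fun t => sidesAt w r (pt t) with hV
  refine ⟨fun p => rank a (stripKey w r p) / L, H ∪ V,
    fun m => card_rank_div_eq_le hinj hL m, ?_, ?_⟩
  · have main : ∀ p ∈ S, ∀ q ∈ S, grid.Adj p q → stripKey w r p < stripKey w r q →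
        rank a (stripKey w r p) / L ≠ rank a (stripKey w r q) / L → s(p, q) ∈ H ∪ V := by
      intro p hp q hq hadj hlt hne
      obtain ⟨t, ht, h1, h2⟩ := exists_separating hinj hlt hne
      rcases side_cases (by exact_mod_cast hw) hadj h1 h2 with ⟨u, hu, hm, he⟩ | h
      · refine Finset.mem_union_left _ (Finset.mem_image.2 ⟨u, Finset.mem_filter.2 ⟨?_, hm⟩, he.symm⟩)
        rcases hu with rfl | rfl <;> assumption
      · exact Finset.mem_union_right _ (Finset.mem_biUnion.2 ⟨t, by simpa using ht, h⟩)
    intro p hp q hq hadj hne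
    rcases lt_trichotomy (stripKey w r p) (stripKey w r q) with h | h | h
    · exact main p hp q hq hadj h hne
    · exact absurd (by simp only [h]) hne
    · rw [Sym2.eq_swap]
      exact main q hq p hp hadj.symm h hne.symm
  · have h1 : V.card ≤ n / L * (w + 1) := by
      refine (Finset.card_biUnion_le_card_mul _ _ _ fun t _ => card_sidesAt_le w r _).trans ?_
      exact Nat.mul_le_mul_right _ (card_dvd_rank_add_one_le hinj L)
    calc w * (H ∪ V).card ≤ w * (H.card + V.card) :=
          Nat.mul_le_mul_left _ (Finset.card_union_le _ _)
      _ = w * H.card + w * V.card := by ring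
      _ ≤ _ := add_le_add ((Nat.mul_le_mul_left _ Finset.card_image_le).trans hr)
        (Nat.mul_le_mul_left _ h1)

end Thompson

namespace Thompson

/-! ### The area-time tradeoff -/

namespace FullyParallelCircuit

variable {α : Type} {n k : ℕ}

/-- The grid squares occupied by nodes or wires. -/
def squares (C : FullyParallelCircuit α n k) : Finset (ℤ × ℤ) :=
  Finset.univ.image C.pos ∪ Finset.univ.biUnion fun w => (C.route w).support.toFinset

/-- Used twice: to have a positive strip width in `sq_outputs_mul_le`, and to pass from `A T²` to `A
T`. -/
theorem inputs_le_area (C : FullyParallelCircuit α n k) : n ≤ C.area := by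
  have h : ((Finset.univ : Finset (Fin n)).image (C.pos ∘ C.inNode)) ⊆ C.squares := by
    intro p hp
    obtain ⟨i, -, rfl⟩ := Finset.mem_image.1 hp
    exact Finset.mem_union_left _ (Finset.mem_image_of_mem _ (Finset.mem_univ _))
  have := Finset.card_le_card h
  rwa [Finset.card_image_of_injective _ (C.pos_injective.comp C.inNode_injective),
    Finset.card_univ, Fintype.card_fin] at this

/-- A wire between different regions crosses a side between different regions. -/
theorem exists_separating_side (C : FullyParallelCircuit α n k) (ρ : ℤ × ℤ → ℕ) {w : C.Wire}
    (h : ρ (C.pos (C.src w)) ≠ ρ (C.pos (C.dst w))) :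
    ∃ p ∈ C.squares, ∃ q ∈ C.squares, grid.Adj p q ∧ ρ p ≠ ρ q ∧ s(p, q) ∈ (C.route w).edges := by
  obtain ⟨d, hd, h1, h2⟩ := (C.route w).exists_boundary_dart
    {p | ρ p = ρ (C.pos (C.src w))} rfl (fun h' => h (Eq.symm h'))
  have hmem : ∀ p ∈ (C.route w).support, p ∈ C.squares := fun p hp =>
    Finset.mem_union_right _ (Finset.mem_biUnion.2 ⟨w, Finset.mem_univ _, by simpa using hp⟩)
  refine ⟨d.fst, hmem _ ((C.route w).dart_fst_mem_support_of_mem_darts hd), d.snd,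
    hmem _ ((C.route w).dart_snd_mem_support_of_mem_darts hd), d.adj, ?_, ?_⟩
  · intro h3
    exact h2 (h3.symm.trans h1)
  · exact List.mem_map.2 ⟨d, hd, rfl⟩

/-- There are at most as many wires between different regions as sides. -/
theorem card_separated_le (C : FullyParallelCircuit α n k) (ρ : ℤ × ℤ → ℕ)
    {E : Finset (Sym2 (ℤ × ℤ))}
    (hE : ∀ p ∈ C.squares, ∀ q ∈ C.squares, grid.Adj p q → ρ p ≠ ρ q → s(p, q) ∈ E) :
    ({w | ρ (C.pos (C.src w)) ≠ ρ (C.pos (C.dst w))} : Finset C.Wire).card ≤ E.card := by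
  have h : ∀ w : C.Wire, ∃ e, ρ (C.pos (C.src w)) ≠ ρ (C.pos (C.dst w)) →
      e ∈ E ∧ e ∈ (C.route w).edges := by
    intro w
    by_cases hw : ρ (C.pos (C.src w)) ≠ ρ (C.pos (C.dst w))
    · obtain ⟨p, hp, q, hq, hadj, hne, hmem⟩ := C.exists_separating_side ρ hw
      exact ⟨s(p, q), fun _ => ⟨hE p hp q hq hadj hne, hmem⟩⟩
    · exact ⟨s((0, 0), (0, 0)), fun h => absurd h hw⟩
  choose g hg using h
  -- The chosen sides are distinct because no side is crossed by two wires.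
  refine Finset.card_le_card_of_injOn g (fun w hw => (hg w (by simpa using hw)).1) ?_
  intro w hw w' hw' heq
  by_contra hne
  refine C.route_disjoint w w' hne (hg w (by simpa using hw)).2 ?_
  rw [heq]
  exact (hg w' (by simpa using hw')).2

open Classical in
/-- Every wire between different regions is cut by exactly two regions. -/
theorem sum_card_cutWires_le (C : FullyParallelCircuit α n k) (ρ : C.Node → ℕ) (J : Finset ℕ) :
    ∑ m ∈ J, (C.cutWires {v | ρ v = m}).card ≤
      2 * ({w | ρ (C.src w) ≠ ρ (C.dst w)} : Finset C.Wire).card := by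
  set W : Finset C.Wire := {w | ρ (C.src w) ≠ ρ (C.dst w)} with hW
  have hfib : ∀ g : C.Wire → ℕ, ∑ m ∈ J, (W.filter fun w => g w = m).card ≤ W.card :=
    fun g => by
      rw [← Finset.card_biUnion]
      · exact Finset.card_le_card (Finset.biUnion_subset.2 fun m _ => Finset.filter_subset _ _)
      · intro m _ m' _ hne
        refine Finset.disjoint_left.2 fun w hw hw' => hne ?_
        rw [← (Finset.mem_filter.1 hw).2, (Finset.mem_filter.1 hw').2]
  -- Each separated wire is counted once at its source and once at its destination, whence the
  -- factor 2.
  have hle : ∀ m ∈ J, (C.cutWires {v | ρ v = m}).card ≤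
      (W.filter fun w => ρ (C.src w) = m).card + (W.filter fun w => ρ (C.dst w) = m).card := by
    intro m _
    refine (Finset.card_le_card fun w hw => ?_).trans (Finset.card_union_le _ _)
    simp only [cutWires, Finset.mem_filter, Finset.mem_univ, true_and, Set.mem_ofPred_eq] at hw
    simp only [hW, Finset.mem_union, Finset.mem_filter, Finset.mem_univ, true_and]
    by_cases h1 : ρ (C.src w) = m <;> by_cases h2 : ρ (C.dst w) = m <;> simp_all
    exact Ne.symm h2
  calc _ ≤ _ := Finset.sum_le_sum hle
    _ = _ := Finset.sum_add_distrib
    _ ≤ W.card + W.card := add_le_add (hfib _) (hfib _)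
    _ = _ := by ring

end FullyParallelCircuit

variable {n k : ℕ} {ε : ℝ}

/-- If the error probability is so small that no region with at most `L` inputs may be erased, then
all outputs are paid for by bits on wires between regions. -/
theorem outputs_le_of_regions (hε0 : 0 ≤ ε) (hε1 : ε ≤ 1)
    (enc : (Fin k → Bool) → Fin n → Bool) (C : FullyParallelCircuit (Option Bool) n k) {L : ℕ}
    (hP : blockErrorProb ε enc C.compute < ε ^ L / 2) (ρ : ℤ × ℤ → ℕ)
    (hρ : ∀ m, ({i | ρ (C.pos (C.inNode i)) = m} : Finset (Fin n)).card ≤ L)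
    {E : Finset (Sym2 (ℤ × ℤ))}
    (hE : ∀ p ∈ C.squares, ∀ q ∈ C.squares, grid.Adj p q → ρ p ≠ ρ q → s(p, q) ∈ E) :
    k ≤ 2 * C.cycles * E.card := by
  classical
  set J := (Finset.univ : Finset (Fin k)).image fun j => ρ (C.pos (C.outNode j)) with hJ
  have hk : k = ∑ m ∈ J, ({j | ρ (C.pos (C.outNode j)) = m} : Finset (Fin k)).card := by
    conv_lhs => rw [← Fintype.card_fin k, ← Finset.card_univ]
    exact Finset.card_eq_sum_card_image _ _
  have hreg : ∀ m ∈ J, ({j | ρ (C.pos (C.outNode j)) = m} : Finset (Fin k)).card ≤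
      C.cycles * (C.cutWires {v | ρ (C.pos v) = m}).card := by
    intro m _
    have h := card_outputs_le hε0 hε1 enc C {v | ρ (C.pos v) = m} (hP.trans_le (by
      refine div_le_div_of_nonneg_right (pow_le_pow_of_le_one hε0 hε1 ?_) (by norm_num)
      simpa using hρ m))
    simpa using h
  calc k = _ := hk
    _ ≤ _ := Finset.sum_le_sum hreg
    _ = C.cycles * ∑ m ∈ J, (C.cutWires {v | ρ (C.pos v) = m}).card := by rw [Finset.mul_sum]
    _ ≤ C.cycles * (2 * E.card) := by
        refine Nat.mul_le_mul_left _ ((C.sum_card_cutWires_le (fun v => ρ (C.pos v)) J).trans ?_)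
        exact Nat.mul_le_mul_left _ (C.card_separated_le ρ hE)
    _ = _ := by ring

/-- The area-time tradeoff for decoders of small error probability. -/
theorem sq_outputs_mul_le (hε0 : 0 ≤ ε) (hε1 : ε ≤ 1)
    (enc : (Fin k → Bool) → Fin n → Bool) (C : FullyParallelCircuit (Option Bool) n k) {L : ℕ}
    (hL : 0 < L) (hP : blockErrorProb ε enc C.compute < ε ^ L / 2) :
    k ^ 2 * L ≤ 144 * (C.area * C.cycles ^ 2) * n := by
  have hpt : Function.Injective fun i => C.pos (C.inNode i) :=
    C.pos_injective.comp C.inNode_injective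
  have hcut : ∀ w : ℕ, 0 < w → ∃ e : ℕ, k ≤ 2 * C.cycles * e ∧
      w * e ≤ C.area + w * (n / L * (w + 1)) := by
    intro w hw
    obtain ⟨ρ, E, h1, h2, h3⟩ := exists_regions C.squares hpt hw hL
    exact ⟨E.card, outputs_le_of_regions hε0 hε1 enc C hP ρ h1 h2, h3⟩
  rcases Nat.eq_zero_or_pos (n / L) with hM | hM
  · obtain ⟨e, h1, h2⟩ := hcut (C.area + 1) (by omega)
    rw [hM] at h2
    have he : e = 0 := by
      by_contra he
      have := Nat.le_mul_of_pos_right (C.area + 1) (Nat.pos_of_ne_zero he)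
      omega
    have hk : k = 0 := by simpa [he] using h1
    simp [hk]
  · set M := n / L with hMdef
    have hMn : M * L ≤ n := Nat.div_mul_le_self n L
    have hMA : M ≤ C.area := (Nat.div_le_self n L).trans C.inputs_le_area
    -- This width balances `A / w` against `M w`. Rounding costs a factor 4 in `A ≤ 4 M w²`, and `w
    -- + 1 ≤ 2 w` costs 2 more, which gives the 6 in `he`.
    set w := Nat.sqrt (C.area / M) with hw
    have hw0 : 0 < w := Nat.sqrt_pos.2 (Nat.div_pos hMA hM)
    have hw1 : M * w ^ 2 ≤ C.area := by
      have := Nat.sqrt_le' (C.area / M)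
      exact (Nat.mul_le_mul_left M this).trans (Nat.mul_div_le _ _)
    have hw2 : C.area ≤ M * (4 * w ^ 2) := by
      have h1 : C.area / M < (w + 1) ^ 2 := Nat.lt_succ_sqrt' _
      have h2 : C.area < (w + 1) ^ 2 * M := (Nat.div_lt_iff_lt_mul hM).1 h1
      have h3 : (w + 1) ^ 2 ≤ 4 * w ^ 2 := by nlinarith
      nlinarith [Nat.mul_le_mul_right M h3]
    obtain ⟨e, h1, h2⟩ := hcut w hw0
    have he : e ≤ 6 * (M * w) := by
      refine Nat.le_of_mul_le_mul_left ?_ hw0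
      have h3 : w * (M * (w + 1)) ≤ w * (M * (2 * w)) :=
        Nat.mul_le_mul_left _ (Nat.mul_le_mul_left _ (by omega))
      nlinarith
    calc k ^ 2 * L ≤ (2 * C.cycles * (6 * (M * w))) ^ 2 * L :=
          Nat.mul_le_mul_right _ (Nat.pow_le_pow_left (h1.trans (Nat.mul_le_mul_left _ he)) 2)
      _ = 144 * (M * w ^ 2 * C.cycles ^ 2) * (M * L) := by ring
      _ ≤ 144 * (C.area * C.cycles ^ 2) * n := by gcongr

/-- The second bound with an arbitrary target `δ` for the error probability. -/
theorem area_mul_sq_cycles_ge (hε0 : 0 < ε) (hε1 : ε < 1)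
    (enc : (Fin k → Bool) → Fin n → Bool) (C : FullyParallelCircuit (Option Bool) n k)
    (hn : 0 < n) {δ : ℝ} (hδ0 : 0 < δ) (hδ1 : δ ≤ 1 / 4) (hδ : 4 ≤ Real.log δ / Real.log ε)
    (hP : blockErrorProb ε enc C.compute < δ) :
    Real.log 2 * (Real.sqrt 2 - 1) ^ 2 / 512 *
        ((k : ℝ) ^ 2 * Real.log δ / ((n : ℝ) * Real.log ε)) ≤
      (C.area : ℝ) * (C.cycles : ℝ) ^ 2 := by
  set X := Real.log δ / Real.log ε with hX
  have hlog : Real.log ε < 0 := Real.log_neg hε0 hε1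
  -- Half of `X` makes `ε ^ L ≥ √δ`, and `√δ ≤ 1 / 2` then absorbs the factor 2 in `δ ≤ ε ^ L / 2`.
  -- The floor stays above `X / 4` because `X ≥ 4`.
  set L := ⌊X / 2⌋₊ with hL
  have hLle : (L : ℝ) ≤ X / 2 := Nat.floor_le (by linarith)
  have hLge : X / 4 ≤ L := by
    have := Nat.lt_floor_add_one (X / 2)
    rw [← hL] at this
    linarith
  have hL0 : 0 < L := by
    have : (0 : ℝ) < L := by linarith
    exact_mod_cast this
  have hδL : δ ≤ ε ^ L / 2 := by
    have h1 : Real.sqrt δ ≤ ε ^ L := by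
      rw [← Real.log_le_log_iff (Real.sqrt_pos.2 hδ0) (by positivity), Real.log_sqrt hδ0.le,
        Real.log_pow]
      have : Real.log δ = X * Real.log ε := (div_mul_cancel₀ _ hlog.ne).symm
      nlinarith
    have h2 : Real.sqrt δ ≤ 1 / 2 := by
      rw [Real.sqrt_le_left (by norm_num)]
      linarith
    have h3 := Real.mul_self_sqrt hδ0.le
    nlinarith [Real.sqrt_nonneg δ]
  have hmain : (k : ℝ) ^ 2 * L ≤ 144 * ((C.area : ℝ) * (C.cycles : ℝ) ^ 2) * n := by
    exact_mod_cast sq_outputs_mul_le hε0.le hε1.le enc C hL0 (hP.trans_le hδL)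
  have hn' : (0 : ℝ) < n := by exact_mod_cast hn
  -- The argument proves the bound with `1 / 576 = 1 / (144 * 4)`, which is better than the constant
  -- claimed.
  have hc : Real.log 2 * (Real.sqrt 2 - 1) ^ 2 / 512 ≤ 1 / 576 := by
    have h1 : Real.log 2 ≤ 1 := by linarith [Real.log_two_lt_d9]
    have h2 : Real.sqrt 2 ≤ 3 / 2 := by
      rw [Real.sqrt_le_left (by norm_num)]
      norm_num
    have h3 : 1 ≤ Real.sqrt 2 := Real.one_le_sqrt.2 (by norm_num)
    have h4 : (Real.sqrt 2 - 1) ^ 2 ≤ 1 / 4 := by nlinarith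
    have h5 := mul_le_mul h1 h4 (sq_nonneg _) zero_le_one
    linarith
  have e : (k : ℝ) ^ 2 * Real.log δ / ((n : ℝ) * Real.log ε) = (k : ℝ) ^ 2 * X / n := by
    rw [hX]
    field_simp
  rw [e]
  calc _ ≤ 1 / 576 * ((k : ℝ) ^ 2 * X / n) :=
        mul_le_mul_of_nonneg_right hc (by positivity)
    _ = 1 / 144 * ((k : ℝ) ^ 2 * (X / 4)) / n := by ring
    _ ≤ _ := by
        rw [div_le_iff₀ hn']
        have := mul_le_mul_of_nonneg_left hLge (sq_nonneg (k : ℝ))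
        linarith

/-- The bound on the energy follows from the bound on `A T ^ 2`, because `A ≥ n`. -/
theorem energy_ge_of_area_mul_sq_cycles_ge {A T X c κ n : ℝ} (hn : 0 < n) (hA : n ≤ A) (hT : 0 ≤ T)
    (hX : 0 ≤ X) (h : c ^ 2 * (κ ^ 2 * X / n) ≤ A * T ^ 2) :
    c * Real.sqrt X * κ ≤ A * T := by
  refine abs_le_of_sq_le_sq' ?_ (mul_nonneg (hn.le.trans hA) hT) |>.2
  have h1 : (c * Real.sqrt X * κ) ^ 2 = c ^ 2 * (κ ^ 2 * X / n) * n := by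
    rw [mul_pow, mul_pow, Real.sq_sqrt hX]
    field_simp
  rw [h1]
  calc _ ≤ A * T ^ 2 * n := mul_le_mul_of_nonneg_right h hn.le
    _ ≤ A * T ^ 2 * A := mul_le_mul_of_nonneg_left hA (mul_nonneg (by linarith) (sq_nonneg _))
    _ = _ := by ring

end Thompson

theorem theorem1 (ε : ℝ) (hε0 : 0 < ε) (hε1 : ε < 1)
    (f : ℕ → ℝ) (hf_pos : ∀ n, 1 ≤ n → 0 < f n)
    (hf_anti : AntitoneOn f (Set.Ici 1)) (hf_lim : Tendsto f atTop (𝓝 0))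
    (hf_sub : Thompson.Sublinear fun n => -Real.log (f n))
    (D : Thompson.DecodingScheme) (hD : D.IsDecodingSchemeFor ε f) :
    ∀ᶠ i in atTop,
      Real.sqrt (Real.log 2) * (Real.sqrt 2 - 1) / (16 * Real.sqrt 2) *
          Real.sqrt (Real.log (f (D.n i)) / Real.log ε) * (D.k i : ℝ)
        ≤ ((D.decoder i).energy : ℝ) ∧
      Real.log 2 * (Real.sqrt 2 - 1) ^ 2 / 512 *
          ((D.k i : ℝ) ^ 2 * Real.log (f (D.n i)) / ((D.n i : ℝ) * Real.log ε))
        ≤ ((D.decoder i).area : ℝ) * ((D.decoder i).cycles : ℝ) ^ 2 := by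
  have hn := D.n_strictMono.tendsto_atTop
  have hlog : Real.log ε < 0 := Real.log_neg hε0 hε1
  -- Since `ln ε < 0`, the condition `f n ≤ ε ^ 4` says that `ln f / ln ε ≥ 4`.
  filter_upwards [hD, hn.eventually (eventually_ge_atTop 1),
    (hf_lim.comp hn).eventually (eventually_le_nhds (show (0 : ℝ) < 1 / 4 by norm_num)),
    (hf_lim.comp hn).eventually (eventually_le_nhds (show (0 : ℝ) < ε ^ 4 by positivity))]
    with i hP hi h1 h2
  simp only [Function.comp_apply] at h1 h2
  have hf0 := hf_pos _ hi
  have hX : 4 ≤ Real.log (f (D.n i)) / Real.log ε := by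
    rw [le_div_iff_of_neg hlog]
    have := Real.log_le_log hf0 h2
    rw [Real.log_pow] at this
    exact_mod_cast this
  have hmain := Thompson.area_mul_sq_cycles_ge hε0 hε1 (D.encoder i) (D.decoder i) hi hf0 h1 hX hP
  refine ⟨?_, hmain⟩
  simp only [Thompson.FullyParallelCircuit.energy, Nat.cast_mul]
  refine Thompson.energy_ge_of_area_mul_sq_cycles_ge (n := D.n i) (by exact_mod_cast hi)
    (by exact_mod_cast (D.decoder i).inputs_le_area) (by positivity) (by linarith) ?_
  refine le_trans (le_of_eq ?_) hmain
  -- The two constants are related by `c₃² = c₄`, since `(16 √2)² = 512`.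
  have hc : (Real.sqrt (Real.log 2) * (Real.sqrt 2 - 1) / (16 * Real.sqrt 2)) ^ 2 =
      Real.log 2 * (Real.sqrt 2 - 1) ^ 2 / 512 := by
    rw [div_pow, mul_pow, mul_pow, Real.sq_sqrt (Real.log_nonneg (by norm_num)),
      Real.sq_sqrt (by norm_num)]
    norm_num
  have hn0 : (D.n i : ℝ) ≠ 0 := by
    have : D.n i ≠ 0 := by omega
    exact_mod_cast this
  rw [hc]
  congr 1
  field_simp
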